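/- Let $\mathbb Z\wr\mathbb Z=\bigl(\bigoplus_{\mathbb Z}\mathbb Z\bigr)\rtimes\mathbb Z$ be the restricted wreath product, with the left-invariant word metric $d(g,h)=|g^{-1}h|_S$ of any finite generating set $S$. For a metric space $X$ and $1\le p<\infty$, the Guentner–Kaminker $\ell^p$ compression rate of $X$ is the supremum of those $\alpha\ge 0$ for which there are a map $f\colon X\to\ell^p(\mathbb N)$ and non-decreasing functions $\rho_-,\rho_+\colon[0,\infty)\to[0,\infty)$ with $$\rho_-(d(x,y))\le\|f(x)-f(y)\|_p\le\rho_+(d(x,y))\quad\text{for all }x,y\in X,\qquad \lim_{t\to\infty}\rho_-(t)=\infty,$$ and $\rho_-(t)\succeq t^\alpha$, i.e. there are constants $C,D>0$ with $\rho_-(t)\ge C(Dt)^\alpha$ for all sufficiently large $t$ (the rate is $0$ if there is no such $\alpha$). Then: 1. for every $1\le p<\infty$, the $\ell^p$ compression rate of $\mathbb Z\wr\mathbb Z$ is at least $1/3$; 2. $\mathbb Z\wr\mathbb Z$ has infinite asymptotic dimension: there is no $m\in\mathbb N$ such that for every $L<\infty$ there are $S'<\infty$ and a cover $\mathfrak U$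 of the group by sets of diameter at most $S'$, with every point in at most $m$ members of $\mathfrak U$, and with Lebesgue number $\inf_x\sup\{r\colon B_r(x)\subset U\text{ for some }U\in\mathfrak U\}$ at least $L$. -/

import Mathlib

open scoped NNReal ENNReal
open Filter

noncomputable section

/-! ### The restricted wreath product -/

/-- The restricted wreath product `H ≀ G = (⨁_G H) ⋊ G`, as the subgroup of the unrestricted regular
wreath product consisting of the pairs whose function part `G → H` has finite support. -/
def restrictedWreathProduct (H G : Type*) [Group H] [Group G] : Subgroup (H ≀ᵣ G) where
  carrier := {x | (Function.mulSupport x.left).Finite}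
  one_mem' := by simp
  mul_mem' := by
    intro a b ha hb
    simp only [Set.mem_ofPred_eq, RegularWreathProduct.mul_left] at ha hb ⊢
    refine (ha.union (hb.image fun x => a.right * x)).subset ?_
    intro x hx
    by_contra hcon
    simp only [Set.mem_union, Set.mem_image, Function.mem_mulSupport, not_or, not_not,
      not_exists, not_and] at hcon
    refine hx ?_
    have h2 : b.left (a.right⁻¹ * x) = 1 := by
      by_contra hne
      exact hcon.2 _ hne (by simp)
    simp [hcon.1, h2]
  inv_mem' := by
    intro a ha
    simp only [Set.mem_ofPred_eq, RegularWreathProduct.inv_left] at ha ⊢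
    refine (ha.image fun x => a.right⁻¹ * x).subset ?_
    intro x hx
    refine ⟨a.right * x, ?_, by simp⟩
    simpa using hx

/-- The group `ℤ ≀ ℤ` (the group `ℤ` being written multiplicatively). -/
abbrev ZwrZ : Type := restrictedWreathProduct (Multiplicative ℤ) (Multiplicative ℤ)

/-! ### Word metrics -/

section Word

variable {G : Type*} [Group G]

/-- The lengths of the words in the letters `S ∪ S⁻¹` that represent `g`. -/
def wordLengths (S : Set G) (g : G) : Set ℕ :=
  {n | ∃ l : List G, l.length = n ∧ (∀ s ∈ l, s ∈ S ∨ s⁻¹ ∈ S) ∧ l.prod = g}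

/-- The word length of `g` with respect to `S`. -/
def wordLength (S : Set G) (g : G) : ℕ := sInf (wordLengths S g)

theorem wordLengths_nonempty {S : Set G} (hS : Subgroup.closure S = ⊤) (g : G) :
    (wordLengths S g).Nonempty := by
  have hg : g ∈ (Subgroup.closure S).toSubmonoid := by simp [hS]
  rw [Subgroup.closure_toSubmonoid] at hg
  obtain ⟨l, hl, hp⟩ := Submonoid.exists_list_of_mem_closure hg
  exact ⟨l.length, l, rfl, fun s hs => by simpa using hl s hs, hp⟩

theorem wordLength_one (S : Set G) : wordLength S 1 = 0 :=
  Nat.le_zero.mp (Nat.sInf_le ⟨[], by simp⟩)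

theorem eq_one_of_wordLength_eq_zero {S : Set G} (hS : Subgroup.closure S = ⊤) {g : G}
    (h : wordLength S g = 0) : g = 1 := by
  obtain ⟨l, hl, -, hp⟩ := Nat.sInf_mem (wordLengths_nonempty hS g)
  have h0 : l.length = 0 := hl.trans h
  rw [List.length_eq_zero_iff] at h0
  simpa [h0] using hp.symm

theorem wordLength_mul_le {S : Set G} (hS : Subgroup.closure S = ⊤) (g h : G) :
    wordLength S (g * h) ≤ wordLength S g + wordLength S h := by
  obtain ⟨l, hl, hl', hp⟩ := Nat.sInf_mem (wordLengths_nonempty hS g)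
  obtain ⟨m, hm, hm', hq⟩ := Nat.sInf_mem (wordLengths_nonempty hS h)
  refine Nat.sInf_le ⟨l ++ m, ?_, ?_, ?_⟩
  · rw [List.length_append, hl, hm]; rfl
  · intro s hs
    rcases List.mem_append.mp hs with hs | hs
    exacts [hl' s hs, hm' s hs]
  · rw [List.prod_append, hp, hq]

theorem wordLength_inv_le {S : Set G} (hS : Subgroup.closure S = ⊤) (g : G) :
    wordLength S g⁻¹ ≤ wordLength S g := by
  obtain ⟨l, hl, hl', hp⟩ := Nat.sInf_mem (wordLengths_nonempty hS g)
  refine Nat.sInf_le ⟨(l.map fun x => x⁻¹).reverse, ?_, ?_, ?_⟩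
  · rw [List.length_reverse, List.length_map, hl]; rfl
  · intro s hs
    simp only [List.mem_reverse, List.mem_map] at hs
    obtain ⟨t, ht, rfl⟩ := hs
    simpa using (hl' t ht).symm
  · rw [← hp, List.prod_inv_reverse]

/-- The group `G` as a metric space, with the left-invariant word metric
`d(g, h) = |g⁻¹ h|` of the generating set `S`. -/
def WordMetricSpace (S : Set G) (_hS : Subgroup.closure S = ⊤) : Type _ := G

instance (S : Set G) (hS : Subgroup.closure S = ⊤) : MetricSpace (WordMetricSpace S hS) where
  dist (g : G) (h : G) := (wordLength S (g⁻¹ * h) : ℝ)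
  dist_self (g : G) := by
    rw [inv_mul_cancel, wordLength_one, Nat.cast_zero]
  dist_comm (g : G) (h : G) := by
    have h1 := wordLength_inv_le hS (g⁻¹ * h)
    have h2 := wordLength_inv_le hS (h⁻¹ * g)
    simp only [mul_inv_rev, inv_inv] at h1 h2
    exact congrArg Nat.cast (le_antisymm h2 h1)
  dist_triangle (g : G) (h : G) (k : G) := by
    have h1 := wordLength_mul_le hS (g⁻¹ * h) (h⁻¹ * k)
    rw [show g⁻¹ * h * (h⁻¹ * k) = g⁻¹ * k by group] at h1
    exact (Nat.cast_le (α := ℝ).mpr h1).trans_eq (Nat.cast_add _ _)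
  eq_of_dist_eq_zero := by
    intro (g : G) (h : G) hd
    have h1 : g⁻¹ * h = 1 := eq_one_of_wordLength_eq_zero hS (Nat.cast_eq_zero.mp hd)
    exact (inv_mul_eq_one (G := G)).mp h1

end Word

/-! ### Compression rate -/

/-- `f ≽ g`: there are positive constants `C` and `D` such that `f t ≥ C * g (D * t)` for all
sufficiently large `t`. -/
def AsympDominates (f g : ℝ≥0 → ℝ≥0) : Prop :=
  ∃ C > 0, ∃ D > 0, ∀ᶠ t in atTop, C * g (D * t) ≤ f t

/-- `f` is a coarse embedding (uniform map) with lower bound `ρ₁` and upper bound `ρ₂`. -/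
structure IsCoarseEmbeddingWith {X Y : Type*} [MetricSpace X] [MetricSpace Y] (f : X → Y)
    (ρ₁ ρ₂ : ℝ≥0 → ℝ≥0) : Prop where
  monotone_lower : Monotone ρ₁
  monotone_upper : Monotone ρ₂
  lower_le : ∀ x y, ρ₁ (nndist x y) ≤ nndist (f x) (f y)
  le_upper : ∀ x y, nndist (f x) (f y) ≤ ρ₂ (nndist x y)
  tendsto_lower : Tendsto ρ₁ atTop atTop

/-- The Guentner–Kaminker `ℓ^p` compression rate of a metric space `X`: the supremum of the
exponents `α ≥ 0` such that `X` admits a coarse embedding into the sequence space `ℓ^p = ℓ^p(ℕ)`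
whose lower bound `ρ₁` satisfies `ρ₁(t) ≽ t ^ α` (and `0` if there is no coarse embedding). -/
def lpCompressionRate (p : ℝ≥0∞) [Fact (1 ≤ p)] (X : Type*) [MetricSpace X] : ℝ≥0∞ :=
  sSup {a | ∃ α : ℝ≥0, a = α ∧ ∃ (f : X → lp (fun _ : ℕ => ℝ) p) (ρ₁ ρ₂ : ℝ≥0 → ℝ≥0),
    IsCoarseEmbeddingWith f ρ₁ ρ₂ ∧ AsympDominates ρ₁ fun t => t ^ (α : ℝ)}

/-! ### Asymptotic dimension -/

section Asdim

variable {X : Type*} [MetricSpace X]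

/-- The Lebesgue number of a family `U` at `x`: the supremum of those `r` for which the ball of
radius `r` around `x` is contained in a member of `U`. -/
def lebesgueNumberAt (U : Set (Set X)) (x : X) : ℝ≥0∞ :=
  sSup {a | ∃ r : ℝ≥0, a = r ∧ ∃ u ∈ U, Metric.ball x r ⊆ u}

/-- The Lebesgue number of a family of sets. -/
def lebesgueNumber (U : Set (Set X)) : ℝ≥0∞ := ⨅ x, lebesgueNumberAt U x

/-- The multiplicity of a family of sets. -/
def coverMultiplicity (U : Set (Set X)) : ℕ∞ := ⨆ x : X, {u ∈ U | x ∈ u}.encard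

/-- The mesh of a family of sets. -/
def coverMesh (U : Set (Set X)) : ℝ≥0∞ := ⨆ u ∈ U, Metric.ediam u

variable (X) in
/-- `asdim X < m`: for every `L < ∞` there are `S < ∞` and a cover of `X` with mesh at most `S`,
multiplicity at most `m` and Lebesgue number at least `L`. -/
def AsdimLT (m : ℕ) : Prop :=
  ∀ L : ℝ≥0, ∃ S : ℝ≥0, ∃ U : Set (Set X), ⋃₀ U = Set.univ ∧
    coverMesh U ≤ S ∧ coverMultiplicity U ≤ m ∧ (L : ℝ≥0∞) ≤ lebesgueNumber U

variable (X) in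
/-- The asymptotic dimension of `X`: the least `k` with `asdim X < k + 1`, and `⊤` if there is
no such `k`. -/
def asymptoticDimension : ℕ∞ := sInf {a | ∃ k : ℕ, a = k ∧ AsdimLT X (k + 1)}

end Asdim

end

/-!
**The compression rate.** Write an element of `ℤ ≀ ℤ` as a lamp configuration `u : ℤ →₀ ℤ`
together with the position of a cursor. The embedding `ZwrZ.coord` records the value of each lamp
and, for each half-line ahead of the cursor, the whole configuration on that half-line, with a
weight `φ` of the distance from the cursor to it. Moving the cursor by one changes these
coordinates by the differences of `φ`, which are `p`-summable, and changing the lamp at the cursor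
changes a single coordinate by one, so the map is Lipschitz. Conversely, let `N` be the distance
between the images of `x` and `y`. If the cursors are `M` apart, or if `x` and `y` differ at a
lamp at distance `M` from the cursor of `x`, then `M` half-lines contribute to the distance, and
the choice of `φ` in `exists_profile` gives `√M ≤ N`. So `x` and `y` differ only within `N²` of
the cursor, and at each lamp by at most `N`; sweeping over this interval
(`ZwrZ.exists_wordLength_le`) shows that the word length of `x⁻¹ y` is at most cubic in `N`, which
is the exponent `1/3`.

**The asymptotic dimension.** The group contains `ℤᵐ` for each `m`, so it suffices that a cover of
`ℤᵐ` with bounded mesh and large Lebesgue number has `m + 1` members with a common point. This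
follows from `Kuhn.exists_rainbow`: a self-map `r` of `ℤᵐ` at bounded distance from the identity
takes `m + 1` distinct values at points close to each other. Its proof is a Sperner-type parity
argument. Label a point by the first nonpositive coordinate, triangulate the slab `0 ≤ x₀ ≤ 1` of
`ℤᵐ⁺¹` as Kuhn does, label its bottom by the labels of the points and its top by the labels of
their images under `r`, and count the facets that carry all labels. As `r` is at bounded distance
from the identity, there are finitely many. Each simplex has none or two of them and each interior
facet lies in two simplices, so the number of them in the two boundary hyperplanes is even. There
is exactly one at the bottom (`Kuhn.eq_standardDoor`), so there is one at the top.
-/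

noncomputable section

/-! ### Coordinates on `ℤ ≀ ℤ` -/

namespace ZwrZ

/-- The position of the cursor: the component of `x` in the acting group `ℤ`. -/
def pos (x : ZwrZ) : ℤ := x.1.right.toAdd

/-- The lamp configuration of `x`, as a finitely supported function `ℤ → ℤ`. -/
def lamp (x : ZwrZ) : ℤ →₀ ℤ :=
  Finsupp.ofSupportFinite (fun j => (x.1.left (Multiplicative.ofAdd j)).toAdd) <| by
    have h : (Function.mulSupport x.1.left).Finite := x.2
    exact (h.image Multiplicative.toAdd).subset fun j hj => ⟨Multiplicative.ofAdd j, hj, rfl⟩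

/-- The element with lamp configuration `u` and cursor at `n`. -/
def mk (u : ℤ →₀ ℤ) (n : ℤ) : ZwrZ :=
  ⟨⟨fun j => Multiplicative.ofAdd (u j.toAdd), Multiplicative.ofAdd n⟩, by
    exact (u.hasFiniteSupport.image Multiplicative.ofAdd).subset fun j hj => ⟨j.toAdd, hj, rfl⟩⟩

@[simp] theorem pos_mk (u : ℤ →₀ ℤ) (n : ℤ) : pos (mk u n) = n := rfl

@[simp] theorem lamp_mk (u : ℤ →₀ ℤ) (n : ℤ) : lamp (mk u n) = u := by ext; rfl

theorem ext {x y : ZwrZ} (h₁ : lamp x = lamp y) (h₂ : pos x = pos y) : x = y := by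
  refine Subtype.ext (RegularWreathProduct.ext (funext fun j => ?_) h₂)
  exact congrArg (fun u : ℤ →₀ ℤ => u j.toAdd) h₁

@[simp] theorem lamp_one : lamp 1 = 0 := by ext; rfl

@[simp] theorem pos_mul (x y : ZwrZ) : pos (x * y) = pos x + pos y := rfl

theorem lamp_mul_apply (x y : ZwrZ) (j : ℤ) :
    lamp (x * y) j = lamp x j + lamp y (j - pos x) := by
  rw [sub_eq_neg_add]; rfl

@[simp] theorem pos_inv (x : ZwrZ) : pos x⁻¹ = -pos x := rfl

theorem lamp_inv_apply (x : ZwrZ) (j : ℤ) : lamp x⁻¹ j = -lamp x (pos x + j) := rfl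

theorem lamp_inv_mul_apply (x y : ZwrZ) (j : ℤ) :
    lamp (x⁻¹ * y) j = lamp y (pos x + j) - lamp x (pos x + j) := by
  rw [lamp_mul_apply, lamp_inv_apply, pos_inv, sub_neg_eq_add, add_comm j]; ring

/-- The elements with all lamps off: the acting copy of `ℤ`. -/
def moveHom : Multiplicative ℤ →* ZwrZ where
  toFun k := mk 0 k.toAdd
  map_one' := ext (by simp) rfl
  map_mul' a b := ext (by ext; simp [lamp_mul_apply]) rfl

/-- The elements with cursor at `0`: the subgroup `⨁_ℤ ℤ`. -/
def lampHom : Multiplicative (ℤ →₀ ℤ) →* ZwrZ where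
  toFun u := mk u.toAdd 0
  map_one' := ext (by simp) rfl
  map_mul' a b := ext (by ext; simp [lamp_mul_apply]) rfl

/-- The generator that moves the cursor one step to the right. -/
def move : ZwrZ := mk 0 1

/-- The generator that adds one to the lamp at the cursor. -/
def toggle : ZwrZ := mk (Finsupp.single 0 1) 0

theorem move_zpow (k : ℤ) : move ^ k = mk 0 k := by
  have h := map_zpow moveHom (Multiplicative.ofAdd 1) k
  rw [← ofAdd_zsmul, smul_eq_mul, mul_one] at h
  exact h.symm

theorem toggle_zpow (k : ℤ) : toggle ^ k = mk (Finsupp.single 0 k) 0 := by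
  have h := map_zpow lampHom (Multiplicative.ofAdd (Finsupp.single 0 1)) k
  rw [← ofAdd_zsmul, Finsupp.smul_single, smul_eq_mul, mul_one] at h
  exact h.symm

/-- The walk that starts at `a`, makes `L` steps to the right, and sets the lamp `a + i` to
`u (a + i)` before the `i`-th step. -/
def sweep (u : ℤ → ℤ) (a : ℤ) (L : ℕ) : ZwrZ :=
  move ^ a * ((List.range L).map fun i : ℕ => toggle ^ u (a + i) * move).prod

theorem sweep_succ (u : ℤ → ℤ) (a : ℤ) (L : ℕ) :
    sweep u a (L + 1) = sweep u a L * toggle ^ u (a + L) * move := by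
  simp [sweep, List.range_succ, mul_assoc]

theorem pos_sweep (u : ℤ → ℤ) (a : ℤ) (L : ℕ) : pos (sweep u a L) = a + L := by
  induction L with
  | zero => simp [sweep, move_zpow]
  | succ L ih => rw [sweep_succ, toggle_zpow, pos_mul, pos_mul, ih]; simp [move, add_assoc]

theorem lamp_sweep_apply (u : ℤ → ℤ) (a : ℤ) (L : ℕ) (j : ℤ) :
    lamp (sweep u a L) j = if a ≤ j ∧ j < a + L then u j else 0 := by
  induction L with
  | zero =>
    have h : ¬ (a ≤ j ∧ j < a + (0 : ℕ)) := by simp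
    rw [if_neg h]; simp [sweep, move_zpow]
  | succ L ih =>
    rw [sweep_succ, lamp_mul_apply, lamp_mul_apply, toggle_zpow, ih, pos_sweep]
    simp only [lamp_mk, move, Finsupp.coe_zero, Pi.zero_apply, add_zero, Finsupp.single_apply]
    push_cast
    split_ifs <;> grind

theorem eq_sweep_mul (h : ZwrZ) (a : ℤ) (L : ℕ)
    (hsupp : ∀ j, lamp h j ≠ 0 → a ≤ j ∧ j < a + L) :
    h = sweep (lamp h) a L * move ^ (pos h - (a + L)) := by
  refine ext ?_ ?_
  · ext j
    rw [lamp_mul_apply, lamp_sweep_apply, move_zpow]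
    have := hsupp j
    split_ifs <;> simp; grind
  · rw [pos_mul, pos_sweep, move_zpow]; simp

theorem lamp_bounded (u : ℤ →₀ ℤ) : ∃ M : ℕ, ∀ j, u j ≠ 0 → -(M : ℤ) ≤ j ∧ j ≤ M := by
  obtain ⟨M, hM⟩ := (u.support.image Int.natAbs).exists_le
  refine ⟨M, fun j hj => ?_⟩
  have := hM _ (Finset.mem_image_of_mem _ (Finsupp.mem_support_iff.mpr hj))
  omega

/-- `move` and `toggle` generate `ℤ ≀ ℤ`. -/
theorem mem_of_generators (K : Subgroup ZwrZ) (hm : move ∈ K) (ht : toggle ∈ K) (h : ZwrZ) :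
    h ∈ K := by
  obtain ⟨M, hM⟩ := lamp_bounded (lamp h)
  rw [eq_sweep_mul h (-M) (2 * M + 1) fun j hj => by have := hM j hj; push_cast; omega]
  refine K.mul_mem (K.mul_mem (K.zpow_mem hm _) (K.list_prod_mem fun g hg => ?_)) (K.zpow_mem hm _)
  obtain ⟨i, -, rfl⟩ := List.mem_map.mp hg
  exact K.mul_mem (K.zpow_mem ht _) hm

end ZwrZ

/-! ### Upper bounds on the word length -/

section Word

variable {G : Type*} [Group G] {S : Set G}

theorem wordLength_inv (hS : Subgroup.closure S = ⊤) (g : G) :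
    wordLength S g⁻¹ = wordLength S g :=
  le_antisymm (wordLength_inv_le hS g) (by simpa using wordLength_inv_le hS g⁻¹)

theorem wordLength_pow_le (hS : Subgroup.closure S = ⊤) (g : G) (n : ℕ) :
    wordLength S (g ^ n) ≤ n * wordLength S g := by
  induction n with
  | zero => simp [wordLength_one]
  | succ n ih =>
    rw [pow_succ]
    have := wordLength_mul_le hS (g ^ n) g
    linarith

theorem wordLength_zpow_le (hS : Subgroup.closure S = ⊤) (g : G) (k : ℤ) :
    wordLength S (g ^ k) ≤ k.natAbs * wordLength S g := by
  obtain ⟨n, rfl | rfl⟩ := k.eq_nat_or_neg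
  · simpa using wordLength_pow_le hS g n
  · simpa [wordLength_inv hS] using wordLength_pow_le hS g n

/-- A map that moves boundedly under right multiplication by each group element is Lipschitz for
the word metric of a finite generating set. -/
theorem exists_norm_sub_le_mul_wordLength (hfin : S.Finite) (hS : Subgroup.closure S = ⊤)
    {E : Type*} [NormedAddCommGroup E] (f : G → E)
    (hf : ∀ g, ∃ C, ∀ x, ‖f (x * g) - f x‖ ≤ C) :
    ∃ C : ℝ≥0, ∀ x y, ‖f y - f x‖ ≤ C * wordLength S (x⁻¹ * y) := by
  choose c hc using hf
  obtain ⟨C, hC⟩ := ((hfin.union hfin.inv).image c).bddAbove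
  suffices h : ∀ x g, ‖f (x * g) - f x‖ ≤ C.toNNReal * wordLength S g from
    ⟨C.toNNReal, fun x y => by simpa using h x (x⁻¹ * y)⟩
  intro x g
  obtain ⟨l, hl, hl', rfl⟩ := Nat.sInf_mem (wordLengths_nonempty hS g)
  change l.length = wordLength S l.prod at hl
  rw [← hl]
  clear hl
  induction l generalizing x with
  | nil => simp
  | cons s l ih =>
    have h₁ : ‖f (x * s) - f x‖ ≤ C.toNNReal :=
      (hc s x).trans <| (hC ⟨s, by simpa using hl' s (by simp), rfl⟩).trans C.le_coe_toNNReal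
    have h₂ := ih (x * s) fun t ht => hl' t (by simp [ht])
    have h₃ := norm_add_le (f (x * s * l.prod) - f (x * s)) (f (x * s) - f x)
    rw [sub_add_sub_cancel] at h₃
    rw [List.prod_cons, ← mul_assoc, List.length_cons]
    push_cast
    linarith

end Word

namespace ZwrZ

variable {S : Set ZwrZ}

/-- Sweeping `[-M, M]` and setting each lamp on the way bounds the word length. -/
theorem exists_wordLength_le (hS : Subgroup.closure S = ⊤) :
    ∃ C : ℕ, ∀ (h : ZwrZ) (M B : ℕ), (∀ j, lamp h j ≠ 0 → j.natAbs ≤ M) →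
      (∀ j, (lamp h j).natAbs ≤ B) → (pos h).natAbs ≤ M →
      wordLength S h ≤ C * ((M + 1) * (B + 1)) := by
  set τ := wordLength S move
  set δ := wordLength S toggle
  have key (u : ℤ → ℤ) (a : ℤ) (B : ℕ) (hB : ∀ j, (u j).natAbs ≤ B) (L : ℕ) :
      wordLength S (sweep u a L) ≤ a.natAbs * τ + L * (B * δ + τ) := by
    induction L with
    | zero => simpa [sweep] using wordLength_zpow_le hS move a
    | succ L ih =>
      rw [sweep_succ]
      have h₁ := wordLength_mul_le hS (sweep u a L * toggle ^ u (a + L)) move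
      have h₂ := wordLength_mul_le hS (sweep u a L) (toggle ^ u (a + L))
      have h₃ := (wordLength_zpow_le hS toggle (u (a + L))).trans
        (Nat.mul_le_mul_right δ (hB (a + L)))
      linarith
  refine ⟨5 * τ + 2 * δ, fun h M B hM hB hp => ?_⟩
  have h₀ := eq_sweep_mul h (-M) (2 * M + 1) fun j hj => by have := hM j hj; push_cast; omega
  have h₁ := wordLength_mul_le hS (sweep (lamp h) (-M) (2 * M + 1))
    (move ^ (pos h - (-(M : ℤ) + (2 * M + 1 : ℕ))))
  rw [← h₀] at h₁
  have h₂ := key (lamp h) (-M) B hB (2 * M + 1)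
  have h₃ := (wordLength_zpow_le hS move (pos h - (-(M : ℤ) + (2 * M + 1 : ℕ)))).trans
    (Nat.mul_le_mul_right τ (show _ ≤ 2 * M + 1 by push_cast; omega))
  rw [show (-(M : ℤ)).natAbs = M by omega] at h₂
  nlinarith [Nat.zero_le (M * B * τ), Nat.zero_le (B * τ), Nat.zero_le (M * δ),
    Nat.zero_le δ, Nat.zero_le τ, Nat.zero_le (B * δ)]

end ZwrZ

/-! ### A combinatorial Lebesgue covering theorem -/

theorem even_ncard_of_involution {α : Type*} {s : Set α} (hs : s.Finite) (f : α → α)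
    (hmem : ∀ a ∈ s, f a ∈ s) (hinv : ∀ a ∈ s, f (f a) = a) (hne : ∀ a ∈ s, f a ≠ a) :
    Even s.ncard := by
  classical
  have h : ∑ a ∈ hs.toFinset, (1 : ZMod 2) = 0 :=
    Finset.sum_involution (fun a _ => f a) (fun _ _ => by decide)
      (fun a ha _ => hne a (hs.mem_toFinset.mp ha))
      (fun a ha => hs.mem_toFinset.mpr (hmem a (hs.mem_toFinset.mp ha)))
      (fun a ha => hinv a (hs.mem_toFinset.mp ha))
  rw [Finset.sum_const, nsmul_one, ZMod.natCast_eq_zero_iff, ← Set.ncard_eq_toFinset_card s hs] at h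
  exact even_iff_two_dvd.mpr h

namespace Kuhn

variable {n : ℕ}

/-- The label of `x : ℤⁿ`: the first index of a nonpositive coordinate, and `n` if all coordinates
are positive. -/
def label (x : Fin n → ℤ) : Fin (n + 1) :=
  have h : ∃ k : ℕ, ∀ hk : k < n, x ⟨k, hk⟩ ≤ 0 := ⟨n, fun hk => absurd hk (lt_irrefl n)⟩
  ⟨Nat.find h, Nat.lt_succ_of_le (Nat.find_min' h fun hk => absurd hk (lt_irrefl n))⟩

theorem nonpos_of_label {x : Fin n → ℤ} {j : Fin n} (h : label x = j.castSucc) : x j ≤ 0 := by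
  have h' : ∃ k : ℕ, ∀ hk : k < n, x ⟨k, hk⟩ ≤ 0 := ⟨n, fun hk => absurd hk (lt_irrefl n)⟩
  have h₁ : Nat.find h' = j := congrArg Fin.val h
  have h₂ := Nat.find_spec h'
  simp only [h₁] at h₂
  exact h₂ j.2

theorem pos_of_lt_label {x : Fin n → ℤ} {j : Fin n} (h : j.castSucc < label x) : 0 < x j := by
  have h' : ∃ k : ℕ, ∀ hk : k < n, x ⟨k, hk⟩ ≤ 0 := ⟨n, fun hk => absurd hk (lt_irrefl n)⟩
  have h₁ := Nat.find_min h' (m := j) h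
  push Not at h₁
  exact h₁.2

theorem label_eq {x : Fin n → ℤ} {i : Fin (n + 1)} (h₁ : ∀ j : Fin n, j.castSucc < i → 0 < x j)
    (h₂ : ∀ j : Fin n, j.castSucc = i → x j ≤ 0) : label x = i := by
  rcases lt_trichotomy (label x) i with h | h | h
  · obtain ⟨j, hj⟩ := Fin.exists_castSucc_eq.mpr (h.trans_le (Fin.le_last i)).ne
    have := h₁ j (hj ▸ h)
    have := nonpos_of_label hj.symm
    omega
  · exact h
  · obtain ⟨j, hj⟩ := Fin.exists_castSucc_eq.mpr (h.trans_le (Fin.le_last _)).ne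
    have := h₂ j hj
    have := pos_of_lt_label (hj ▸ h)
    omega

theorem label_mono : Monotone (label (n := n)) := by
  intro x y hxy
  by_contra! h
  obtain ⟨j, hj⟩ := Fin.exists_castSucc_eq.mpr (h.trans_le (Fin.le_last _)).ne
  have h₁ := nonpos_of_label hj.symm
  have h₂ := pos_of_lt_label (hj ▸ h)
  have : x j ≤ y j := hxy j
  omega

/-- The steps of a Kuhn simplex: the unit vectors, and the vector with all entries `-1`, which
leads from the last vertex back to the first. -/
def step : Option (Fin (n + 1)) → Fin (n + 1) → ℤ
  | none => fun _ => -1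
  | some i => Pi.single i 1

theorem step_injective : Function.Injective (step (n := n)) := by
  rintro (_ | i) (_ | j) h
  · rfl
  · have := congrFun h j
    simp [step] at this
  · have := congrFun h i
    simp [step] at this
  · by_contra hij
    have := congrFun h i
    simp [step, Pi.single_apply] at this
    exact hij (by rw [this])

/-- The `(n + 1)`-dimensional simplices of Kuhn's triangulation of `ℝⁿ⁺¹`, with their vertices in
cyclic order: the steps between consecutive vertices are `e₀, …, eₙ` and `-(e₀ + ⋯ + eₙ)`, each
occurring once. Every cyclic rotation of a simplex is a simplex. -/
def IsSimplex (v : Fin (n + 2) → Fin (n + 1) → ℤ) : Prop :=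
  ∃ σ : Fin (n + 2) → Option (Fin (n + 1)), Function.Injective σ ∧
    ∀ i, v (i + 1) = v i + step (σ i)

theorem IsSimplex.rotate {v : Fin (n + 2) → Fin (n + 1) → ℤ} (hv : IsSimplex v)
    (k : Fin (n + 2)) : IsSimplex fun i => v (i + k) := by
  obtain ⟨σ, hσ, h⟩ := hv
  exact ⟨fun i => σ (i + k), hσ.comp (add_left_injective k), fun i => by
    change v (i + 1 + k) = v (i + k) + step (σ (i + k))
    rw [add_right_comm, h]⟩

theorem IsSimplex.rotate_ne {v : Fin (n + 2) → Fin (n + 1) → ℤ} (hv : IsSimplex v)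
    {k : Fin (n + 2)} (hk : k ≠ 0) : (fun i => v (i + k)) ≠ v := by
  obtain ⟨σ, hσ, h⟩ := hv
  intro heq
  have h₀ : v (0 + k) = v 0 := congrFun heq 0
  have h₁ : v (0 + 1 + k) = v (0 + 1) := congrFun heq (0 + 1)
  rw [add_right_comm, h, h, h₀] at h₁
  exact hk (by simpa using hσ (step_injective (add_left_cancel h₁)))

/-- The simplex across the facet opposite to the vertex `v 0`. -/
def flip (v : Fin (n + 2) → Fin (n + 1) → ℤ) : Fin (n + 2) → Fin (n + 1) → ℤ :=
  Function.update v 0 (v 1 + v (-1) - v 0)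

theorem flip_zero (v : Fin (n + 2) → Fin (n + 1) → ℤ) : flip v 0 = v 1 + v (-1) - v 0 := by
  simp [flip]

theorem flip_of_ne (v : Fin (n + 2) → Fin (n + 1) → ℤ) {i : Fin (n + 2)} (hi : i ≠ 0) :
    flip v i = v i := by
  simp [flip, hi]

theorem flip_flip (v : Fin (n + 2) → Fin (n + 1) → ℤ) : flip (flip v) = v := by
  funext i
  by_cases hi : i = 0
  · subst hi
    rw [flip_zero, flip_zero, flip_of_ne v one_ne_zero, flip_of_ne v (by simp)]
    abel
  · rw [flip_of_ne _ hi, flip_of_ne _ hi]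

theorem IsSimplex.flip {v : Fin (n + 2) → Fin (n + 1) → ℤ} (hv : IsSimplex v) :
    IsSimplex (flip v) := by
  obtain ⟨σ, hσ, h⟩ := hv
  have h₀ : v 1 = v 0 + step (σ 0) := by simpa using h 0
  have h₁ : v 0 = v (-1) + step (σ (-1)) := by simpa using h (-1)
  refine ⟨σ ∘ Equiv.swap 0 (-1), hσ.comp (Equiv.injective _), fun i => ?_⟩
  by_cases hi : i = 0
  · subst hi
    rw [zero_add, flip_of_ne v one_ne_zero, flip_zero, Function.comp, Equiv.swap_apply_left, h₀]
    nth_rw 3 [h₁]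
    abel
  · rw [flip_of_ne v hi]
    by_cases hi' : i = -1
    · subst hi'
      rw [neg_add_cancel, flip_zero, Function.comp, Equiv.swap_apply_right, h₀]
      abel
    · rw [flip_of_ne v fun h0 => hi' (eq_neg_of_add_eq_zero_left h0), Function.comp,
        Equiv.swap_apply_of_ne_of_ne hi hi', h]

theorem IsSimplex.flip_ne {v : Fin (n + 2) → Fin (n + 1) → ℤ} (hv : IsSimplex v) :
    Kuhn.flip v ≠ v := by
  obtain ⟨σ, hσ, h⟩ := hv
  have h₀ : v 1 = v 0 + step (σ 0) := by simpa using h 0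
  have h₁ : v 0 = v (-1) + step (σ (-1)) := by simpa using h (-1)
  intro heq
  have h₂ := congrFun heq 0
  rw [flip_zero, sub_eq_iff_eq_add, h₀, add_assoc] at h₂
  nth_rw 3 [h₁] at h₂
  rw [add_left_cancel_iff, add_comm (step (σ 0))] at h₂
  simpa using hσ (step_injective (add_left_cancel h₂))

theorem abs_step_le (s : Option (Fin (n + 1))) (j : Fin (n + 1)) : |step s j| ≤ 1 := by
  rcases s with _ | i
  · simp [step]
  · simp only [step, Pi.single_apply]
    split_ifs <;> simp

theorem IsSimplex.abs_sub_le {v : Fin (n + 2) → Fin (n + 1) → ℤ} (hv : IsSimplex v)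
    (i k : Fin (n + 2)) (j : Fin (n + 1)) : |v i j - v k j| ≤ 2 * (n + 1) := by
  obtain ⟨σ, -, h⟩ := hv
  have key (i : Fin (n + 2)) : |v i j - v 0 j| ≤ (i : ℕ) := by
    induction i using Fin.induction with
    | zero => simp
    | succ i ih =>
      rw [← Fin.coeSucc_eq_succ, h, Pi.add_apply, Fin.coeSucc_eq_succ]
      have := abs_step_le (σ i.castSucc) j
      simp only [Fin.val_succ, Fin.val_castSucc] at ih ⊢
      push_cast
      rw [abs_le] at *
      omega
  have h₁ := key i
  have h₂ := key k
  rw [abs_le] at *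
  omega

/-- The simplices in the slab `0 ≤ x₀ ≤ 1` whose facet opposite to the vertex `v 0` carries each
label exactly once. -/
def doors (Λ : (Fin (n + 1) → ℤ) → Fin (n + 1)) : Set (Fin (n + 2) → Fin (n + 1) → ℤ) :=
  {v | IsSimplex v ∧ (∀ i, 0 ≤ v i 0 ∧ v i 0 ≤ 1) ∧
    Function.Injective fun i : Fin (n + 1) => Λ (v i.succ)}

/-- The doors whose distinguished facet lies in the hyperplane `x₀ = t`. -/
def boundaryDoors (Λ : (Fin (n + 1) → ℤ) → Fin (n + 1)) (t : ℤ) :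
    Set (Fin (n + 2) → Fin (n + 1) → ℤ) :=
  {v | v ∈ doors Λ ∧ ∀ i, i ≠ 0 → v i 0 = t}

/-- Each simplex with a door has exactly one other door, found by rotating the vertices. -/
theorem even_ncard_doors {Λ : (Fin (n + 1) → ℤ) → Fin (n + 1)} (hfin : (doors Λ).Finite) :
    Even (doors Λ).ncard := by
  classical
  have hinj {v} (hv : v ∈ doors Λ) {a b : Fin (n + 2)} (ha : a ≠ 0) (hb : b ≠ 0)
      (hab : Λ (v a) = Λ (v b)) : a = b := by
    obtain ⟨a, rfl⟩ := Fin.exists_succ_eq.mpr ha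
    obtain ⟨b, rfl⟩ := Fin.exists_succ_eq.mpr hb
    rw [hv.2.2 hab]
  have hex (v : Fin (n + 2) → Fin (n + 1) → ℤ) (hv : v ∈ doors Λ) :
      ∃ k, k ≠ 0 ∧ Λ (v k) = Λ (v 0) := by
    obtain ⟨i, hi⟩ := (Finite.injective_iff_surjective.mp hv.2.2) (Λ (v 0))
    exact ⟨i.succ, Fin.succ_ne_zero i, hi⟩
  choose! k hk hkΛ using hex
  have hrot {v} (hv : v ∈ doors Λ) : (fun i => v (i + k v)) ∈ doors Λ := by
    refine ⟨hv.1.rotate _, fun i => hv.2.1 _, fun i j hij => ?_⟩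
    simp only at hij
    have ne (i : Fin (n + 1)) : i.succ + k v ≠ k v := by simp [Fin.succ_ne_zero]
    have hij' : i.succ + k v = j.succ + k v := by
      by_cases hi : i.succ + k v = 0 <;> by_cases hj : j.succ + k v = 0
      · rw [hi, hj]
      · rw [hi, ← hkΛ v hv] at hij
        exact absurd (hinj hv (hk v hv) hj hij).symm (ne j)
      · rw [hj, ← hkΛ v hv] at hij
        exact absurd (hinj hv hi (hk v hv) hij) (ne i)
      · exact hinj hv hi hj hij
    simpa using hij'
  refine even_ncard_of_involution hfin (fun v i => v (i + k v)) (fun v hv => hrot hv)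
    (fun v hv => ?_) (fun v hv => hv.1.rotate_ne (hk v hv))
  have hk' : k (fun i => v (i + k v)) = -k v := by
    refine hinj (hrot hv) (hk _ (hrot hv)) (neg_ne_zero.mpr (hk v hv)) ?_
    rw [hkΛ _ (hrot hv), neg_add_cancel, zero_add, hkΛ v hv]
  funext i
  simp only [hk', neg_add_cancel_right]

/-- A door that does not lie in the boundary of the slab belongs to exactly two simplices of the
slab. -/
theorem even_ncard_interior_doors {Λ : (Fin (n + 1) → ℤ) → Fin (n + 1)}
    (hfin : (doors Λ).Finite) :
    Even (doors Λ \ (boundaryDoors Λ 0 ∪ boundaryDoors Λ 1)).ncard := by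
  refine even_ncard_of_involution (hfin.subset Set.sdiff_subset) flip (fun v hv => ?_)
    (fun v _ => flip_flip v) (fun v hv => hv.1.1.flip_ne)
  obtain ⟨⟨hs, hslab, hΛ⟩, hb⟩ := hv
  have hne (i : Fin (n + 2)) (hi : i ≠ 0) : flip v i 0 = v i 0 := by rw [flip_of_ne v hi]
  have h01 : v 1 0 = v 0 0 ∨ v (-1) 0 = v 0 0 ∨ v 1 0 ≠ v (-1) 0 := by
    -- Otherwise both steps at `v 0` change the coordinate `x₀`, so no other step does.
    by_contra! hcon
    obtain ⟨h1, h2, h3⟩ := hcon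
    obtain ⟨σ, hσ, h⟩ := hs
    have h₀ : v 1 = v 0 + step (σ 0) := by simpa using h 0
    have h₁ : v 0 = v (-1) + step (σ (-1)) := by simpa using h (-1)
    have hσ0 : step (σ 0) 0 ≠ 0 := fun h0 => h1 (by rw [h₀, Pi.add_apply, h0, add_zero])
    have hσ1 : step (σ (-1)) 0 ≠ 0 := fun h0 => h2 (by rw [h₁, Pi.add_apply, h0, add_zero])
    have hstep (s : Option (Fin (n + 1))) (hs : step s 0 ≠ 0) : s = none ∨ s = some 0 := by
      rcases s with _ | i
      · exact Or.inl rfl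
      · refine Or.inr (congrArg some ?_)
        by_contra hi
        exact hs (by simp [step, Ne.symm hi])
    have hσ' (i : Fin (n + 2)) (hi : i ≠ 0) (hi' : i ≠ -1) : step (σ i) 0 = 0 := by
      by_contra h0
      have e0 : σ 0 ≠ σ (-1) := fun e => by simpa using hσ e
      have e1 : σ i ≠ σ 0 := fun e => hi (hσ e)
      have e2 : σ i ≠ σ (-1) := fun e => hi' (hσ e)
      rcases hstep _ h0 with a | a <;> rcases hstep _ hσ0 with b | b <;>
        rcases hstep _ hσ1 with c | c <;> simp_all
    have hconst (i : Fin (n + 1)) : v i.succ 0 = v 1 0 := by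
      induction i using Fin.induction with
      | zero => rfl
      | succ i ih =>
        have hsucc : i.succ.succ = i.castSucc.succ + 1 := by
          rw [Fin.succ_castSucc, Fin.coeSucc_eq_succ]
        rw [hsucc, h, Pi.add_apply, ih, hσ' _ (Fin.succ_ne_zero _), add_zero]
        intro e
        rw [e, neg_add_cancel] at hsucc
        exact Fin.succ_ne_zero _ hsucc
    refine hb ?_
    have hall (i : Fin (n + 2)) (hi : i ≠ 0) : v i 0 = v 1 0 := by
      obtain ⟨i, rfl⟩ := Fin.exists_succ_eq.mpr hi
      exact hconst i
    have := hslab 1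
    rcases (show v 1 0 = 0 ∨ v 1 0 = 1 by omega) with h | h
    · exact Or.inl ⟨⟨⟨σ, hσ, ‹_›⟩, hslab, hΛ⟩, fun i hi => (hall i hi).trans h⟩
    · exact Or.inr ⟨⟨⟨σ, hσ, ‹_›⟩, hslab, hΛ⟩, fun i hi => (hall i hi).trans h⟩
  have hmem : flip v ∈ doors Λ := by
    refine ⟨hs.flip, fun i => ?_, fun i j hij => hΛ ?_⟩
    · by_cases hi : i = 0
      · subst hi
        rw [flip_zero, Pi.sub_apply, Pi.add_apply]
        have := hslab 0
        have := hslab 1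
        have := hslab (-1)
        omega
      · rw [hne i hi]; exact hslab i
    · simpa only [flip_of_ne v (Fin.succ_ne_zero _)] using hij
  refine ⟨hmem, fun hb' => hb ?_⟩
  rcases hb' with h | h
  · exact Or.inl ⟨⟨hs, hslab, hΛ⟩, fun i hi => (hne i hi).symm.trans (h.2 i hi)⟩
  · exact Or.inr ⟨⟨hs, hslab, hΛ⟩, fun i hi => (hne i hi).symm.trans (h.2 i hi)⟩


/-- The simplex with vertices `1, 0, e₁, e₁ + e₂, …, e₁ + ⋯ + eₙ` in cyclic order. -/
def standardDoor : Fin (n + 2) → Fin (n + 1) → ℤ :=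
  Fin.cons (fun _ => 1) fun i => Fin.cons 0 fun j => if j.castSucc < i then 1 else 0

theorem standardDoor_mem (Λ : (Fin (n + 1) → ℤ) → Fin (n + 1))
    (hΛ : ∀ x, x 0 = 0 → Λ x = label (Fin.tail x)) : standardDoor ∈ boundaryDoors Λ 0 := by
  have hlabel (i : Fin (n + 1)) : Λ (standardDoor i.succ) = i := by
    rw [hΛ _ (by simp [standardDoor])]
    exact label_eq (fun j hj => by simp [standardDoor, Fin.tail, hj])
      (fun j hj => by simp [standardDoor, Fin.tail, hj])
  refine ⟨⟨⟨Fin.cons none fun i => some (i + 1), ?_, fun i => ?_⟩, fun i => ?_, fun i j hij => ?_⟩,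
    fun i hi => ?_⟩
  · refine Fin.cons_injective_iff.mpr ⟨by rintro ⟨i, hi⟩; simp at hi, fun i j hij => ?_⟩
    simpa using hij
  · induction i using Fin.cases with
    | zero =>
      rw [zero_add, ← Fin.succ_zero_eq_one]
      funext j
      induction j using Fin.cases <;> simp [standardDoor, step]
    | succ i =>
      induction i using Fin.lastCases with
      | last =>
        rw [Fin.succ_last, Fin.last_add_one, ← Fin.succ_last]
        funext j
        induction j using Fin.cases <;>
          simp [standardDoor, step, Fin.castSucc_lt_last]
      | cast i =>
        rw [Fin.succ_castSucc, Fin.coeSucc_eq_succ, ← Fin.succ_castSucc]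
        funext j
        induction j using Fin.cases with
        | zero => simp [standardDoor, step, Fin.ext_iff]
        | succ j =>
          simp only [standardDoor, step, Pi.single_apply, Fin.cons_succ, Pi.add_apply,
            Fin.coeSucc_eq_succ, Fin.lt_def, Fin.ext_iff, Fin.val_castSucc,
            Fin.val_succ]
          split_ifs <;> omega
  · induction i using Fin.cases <;> simp [standardDoor]
  · simpa only [hlabel] using hij
  · obtain ⟨i, rfl⟩ := Fin.exists_succ_eq.mpr hi
    simp [standardDoor]

/-- Along the distinguished facet of a door in the hyperplane `x₀ = 0` the labels increase, so they
are `0, …, n` in this order, and this determines the facet. -/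
theorem eq_standardDoor {Λ : (Fin (n + 1) → ℤ) → Fin (n + 1)}
    (hΛ : ∀ x, x 0 = 0 → Λ x = label (Fin.tail x)) {v : Fin (n + 2) → Fin (n + 1) → ℤ}
    (hv : v ∈ boundaryDoors Λ 0) : v = standardDoor := by
  obtain ⟨⟨⟨σ, hσ, h⟩, hslab, hinj⟩, hb⟩ := hv
  have hb' (i : Fin (n + 1)) : v i.succ 0 = 0 := hb _ (Fin.succ_ne_zero i)
  have hsurj : Function.Surjective σ :=
    ((Fintype.bijective_iff_injective_and_card σ).mpr ⟨hσ, by simp⟩).2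
  have hnext (i : Fin n) : v i.succ.succ = v i.castSucc.succ + step (σ i.castSucc.succ) := by
    rw [← h, Fin.succ_castSucc, Fin.coeSucc_eq_succ]
  have hstep0 (i : Fin n) : step (σ i.castSucc.succ) 0 = 0 := by
    have := congrFun (hnext i) 0
    rw [Pi.add_apply, hb', hb', zero_add] at this
    exact this.symm
  have hnone_last : σ (Fin.last (n + 1)) ≠ none := by
    intro hnone
    have h₁ := congrFun (h (Fin.last (n + 1))) 0
    rw [Fin.last_add_one, Pi.add_apply, hnone, ← Fin.succ_last, hb'] at h₁
    have := (hslab 0).1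
    simp [step] at h₁
    omega
  have hσ0 : σ 0 = none := by
    obtain ⟨i, hi⟩ := hsurj none
    induction i using Fin.cases with
    | zero => exact hi
    | succ i =>
      induction i using Fin.lastCases with
      | last => exact absurd hi hnone_last
      | cast i => have := hstep0 i; simp [hi, step] at this
  have hsome (i : Fin n) : ∃ j : Fin n, σ i.castSucc.succ = some j.succ := by
    rcases hs : σ i.castSucc.succ with _ | j
    · exact absurd (hσ (hs.trans hσ0.symm)) (Fin.succ_ne_zero _)
    · induction j using Fin.cases with
      | zero => have := hstep0 i; simp [hs, step] at this
      | succ j => exact ⟨j, rfl⟩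
  choose π hπ using hsome
  set w : Fin (n + 1) → Fin n → ℤ := fun i => Fin.tail (v i.succ) with hw
  have hwstep (i : Fin n) (j : Fin n) :
      w i.succ j = w i.castSucc j + if j = π i then 1 else 0 := by
    simp only [hw, Fin.tail]
    rw [hnext, hπ, Pi.add_apply, step, Pi.single_apply]
    simp
  have hwmono : Monotone w := Fin.monotone_iff_le_succ.mpr fun i j => by
    change w i.castSucc j ≤ w i.succ j
    rw [hwstep]; split_ifs <;> omega
  have hlabel (i : Fin (n + 1)) : label (w i) = i := by
    have hmono : StrictMono fun i => label (w i) :=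
      (label_mono.comp hwmono).strictMono_of_injective fun i j hij => hinj (by
        simp only [Function.comp] at hij
        simp only
        rw [hΛ _ (hb' i), hΛ _ (hb' j)]
        exact hij)
    have hid := (hmono.range_inj strictMono_id).mp (by
      rw [(Finite.injective_iff_surjective.mp hmono.injective).range_eq, Set.range_id])
    exact congrFun hid i
  have hle (j : Fin n) : w j.castSucc j ≤ 0 := nonpos_of_label (hlabel _)
  have hpos (j : Fin n) : 0 < w j.succ j :=
    pos_of_lt_label (by rw [hlabel]; exact Fin.castSucc_lt_succ)
  have hπid (j : Fin n) : π j = j := by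
    have h₁ := hwstep j j
    have := hle j
    have := hpos j
    by_contra hne
    rw [if_neg (Ne.symm hne)] at h₁
    omega
  have hdiag (j : Fin n) : w j.castSucc j = 0 := by
    have h₁ := hwstep j j
    have := hle j
    have := hpos j
    rw [hπid, if_pos rfl] at h₁
    omega
  have hconst (i : Fin (n + 1)) (j : Fin n) :
      w i j - (if j.castSucc < i then 1 else 0) = w 0 j := by
    induction i using Fin.induction with
    | zero => simp
    | succ i ih =>
      rw [← ih, hwstep, hπid]
      simp only [Fin.lt_def, Fin.ext_iff, Fin.val_castSucc, Fin.val_succ]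
      split_ifs <;> omega
  have hw0 (j : Fin n) : w 0 j = 0 := by
    rw [← hconst j.castSucc j, hdiag]; simp
  have hv0 : v 0 = fun _ => 1 := by
    have h₁ := h 0
    rw [hσ0, zero_add, ← Fin.succ_zero_eq_one] at h₁
    funext j
    have h₂ := congrFun h₁ j
    have h₃ : v (Fin.succ 0) j = 0 := by
      induction j using Fin.cases with
      | zero => exact hb' 0
      | succ j => exact hw0 j
    rw [h₃] at h₂
    simp only [Pi.add_apply, step] at h₂
    omega
  funext i j
  induction i using Fin.cases with
  | zero => simp [standardDoor, hv0]
  | succ i =>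
    induction j using Fin.cases with
    | zero => simp [standardDoor, hb']
    | succ j =>
      have := hconst i j
      rw [hw0] at this
      simp only [standardDoor, Fin.cons_succ]
      change w i j = _
      omega

theorem finite_doors {Λ : (Fin (n + 1) → ℤ) → Fin (n + 1)} {D : ℤ}
    (hΛ : ∀ x, ∃ y, Λ x = label y ∧ ∀ j, |y j - x j.succ| ≤ D) : (doors Λ).Finite := by
  set R : ℤ := |D| + 2 * (n + 1) + 1 with hR
  refine (Set.finite_Icc (fun _ _ => -R) (fun _ _ => R)).subset fun v hv => ?_
  obtain ⟨hs, hslab, hinj⟩ := hv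
  have hsurj := Finite.injective_iff_surjective.mp hinj
  have hD := le_abs_self D
  have hD' := abs_nonneg D
  have key (i : Fin (n + 2)) (j : Fin (n + 1)) : -R ≤ v i j ∧ v i j ≤ R := by
    induction j using Fin.cases with
    | zero => have := hslab i; omega
    | succ j =>
      -- The label `j` bounds the `j`-th coordinate from above, and the label `n` from below.
      obtain ⟨k, hk⟩ := hsurj j.castSucc
      obtain ⟨l, hl⟩ := hsurj (Fin.last n)
      obtain ⟨y, hy, hyD⟩ := hΛ (v k.succ)
      obtain ⟨z, hz, hzD⟩ := hΛ (v l.succ)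
      have h₁ := nonpos_of_label (hy.symm.trans hk)
      have h₂ : 0 < z j := pos_of_lt_label (by
        rw [hz.symm.trans hl]; exact Fin.castSucc_lt_last j)
      have h₃ := hs.abs_sub_le i k.succ j.succ
      have h₄ := hs.abs_sub_le i l.succ j.succ
      have h₅ := hyD j
      have h₆ := hzD j
      rw [abs_le] at h₃ h₄ h₅ h₆
      omega
  exact ⟨fun i j => (key i j).1, fun i j => (key i j).2⟩

/-- A self-map of `ℤⁿ` at bounded distance from the identity takes `n + 1` distinct values at
suitable `n + 1` points close to each other: a coarse form of the Lebesgue covering theorem. -/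
theorem exists_rainbow (r : (Fin n → ℤ) → Fin n → ℤ) (D : ℤ) (hr : ∀ x j, |r x j - x j| ≤ D) :
    ∃ w : Fin (n + 1) → Fin n → ℤ, Function.Injective (fun i => r (w i)) ∧
      ∀ i k j, |w i j - w k j| ≤ 2 * (n + 1) := by
  -- Interpolate between the labelling of the identity at height `0` and that of `r` at height `1`.
  set Λ : (Fin (n + 1) → ℤ) → Fin (n + 1) := fun x =>
    if x 0 = 0 then label (Fin.tail x) else label (r (Fin.tail x)) with hΛ
  have hΛ0 (x : Fin (n + 1) → ℤ) (hx : x 0 = 0) : Λ x = label (Fin.tail x) := if_pos hx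
  have hfin : (doors Λ).Finite := finite_doors (D := D) fun x => by
    have hD : 0 ≤ D ∨ n = 0 := by
      rcases n with _ | n
      · exact Or.inr rfl
      · exact Or.inl ((abs_nonneg _).trans (hr 0 0))
    by_cases hx : x 0 = 0
    · refine ⟨Fin.tail x, if_pos hx, fun j => ?_⟩
      rw [Fin.tail, sub_self, abs_zero]
      exact hD.resolve_right (by have := j.pos; omega)
    · exact ⟨r (Fin.tail x), if_neg hx, hr (Fin.tail x)⟩
  have hsub : boundaryDoors Λ 0 ∪ boundaryDoors Λ 1 ⊆ doors Λ :=
    Set.union_subset (fun _ h => h.1) (fun _ h => h.1)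
  have hone : (boundaryDoors Λ 0).ncard = 1 := Set.ncard_eq_one.mpr
    ⟨standardDoor, Set.eq_singleton_iff_unique_mem.mpr
      ⟨standardDoor_mem Λ hΛ0, fun v hv => eq_standardDoor hΛ0 hv⟩⟩
  have hnonempty : (boundaryDoors Λ 1).Nonempty := by
    by_contra hempty
    rw [Set.not_nonempty_iff_eq_empty] at hempty
    have h₁ := Set.ncard_sdiff_add_ncard_of_subset hsub hfin
    have h₂ := even_ncard_interior_doors hfin
    have h₃ := even_ncard_doors hfin
    rw [hempty, Set.union_empty] at h₁ h₂
    rw [hone] at h₁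
    rw [← h₁] at h₃
    exact (Nat.not_even_iff_odd.mpr h₂.add_one) h₃
  obtain ⟨v, ⟨hs, -, hinj⟩, hv⟩ := hnonempty
  refine ⟨fun i => Fin.tail (v i.succ), fun i k hik => hinj ?_,
    fun i k j => hs.abs_sub_le _ _ _⟩
  have h1 (i : Fin (n + 1)) : Λ (v i.succ) = label (r (Fin.tail (v i.succ))) :=
    if_neg (by rw [hv _ (Fin.succ_ne_zero i)]; exact one_ne_zero)
  simp only [h1]
  exact congrArg label hik

end Kuhn

/-! ### Coarse embeddings into `ℓ^p` -/

/-- A function on `ℤ` that vanishes on `(-∞, 0]`, has `p`-summable differences, and has `ℓ^p` norm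
at least `√M` on `[1, M]`. The Heaviside function serves for `p ≤ 2`, the square root for `2 < p`.
-/
theorem exists_profile {p : ℝ} (hp : 1 ≤ p) : ∃ φ : ℤ → ℝ, (∀ j ≤ 0, φ j = 0) ∧
    (Summable fun j => |φ (j + 1) - φ j| ^ p) ∧
    ∀ M : ℕ, (M : ℝ) ^ (p / 2) ≤ ∑ j ∈ Finset.range M, |φ (j + 1)| ^ p := by
  have hp0 : p ≠ 0 := by positivity
  rcases le_or_gt p 2 with h2 | h2
  · refine ⟨fun j => if 0 < j then 1 else 0, fun j hj => if_neg (not_lt.mpr hj), ?_, fun M => ?_⟩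
    · refine summable_of_ne_finset_zero (s := {0}) fun j hj => ?_
      rw [Finset.mem_singleton] at hj
      have h : (0 < j + 1) ↔ 0 < j := by omega
      simp [h, Real.zero_rpow hp0]
    · have h (j : ℕ) : (0 : ℤ) < j + 1 := by positivity
      simp only [h, if_true, abs_one, Real.one_rpow, Finset.sum_const, Finset.card_range,
        nsmul_eq_mul, mul_one]
      rcases M.eq_zero_or_pos with rfl | hM
      · rw [Nat.cast_zero, Real.zero_rpow (by positivity)]
      · calc (M : ℝ) ^ (p / 2) ≤ (M : ℝ) ^ (1 : ℝ) :=
              Real.rpow_le_rpow_of_exponent_le (by exact_mod_cast hM) (by linarith)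
          _ = M := Real.rpow_one _
  · refine ⟨fun j => √j, fun j hj => Real.sqrt_eq_zero_of_nonpos (by exact_mod_cast hj), ?_,
      fun M => ?_⟩
    · refine Summable.of_norm_bounded_eventually
        (Real.summable_abs_int_rpow (b := p / 2) (by linarith)) ?_
      filter_upwards [eventually_cofinite_ne (0 : ℤ)] with j hj
      rw [Real.norm_of_nonneg (by positivity)]
      rcases lt_or_gt_of_ne hj with hj | hj
      · have h₁ : ((j + 1 : ℤ) : ℝ) ≤ 0 := by exact_mod_cast hj
        have h₂ : ((j : ℤ) : ℝ) ≤ 0 := by exact_mod_cast hj.le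
        rw [Real.sqrt_eq_zero_of_nonpos h₁, Real.sqrt_eq_zero_of_nonpos h₂, sub_zero, abs_zero,
          Real.zero_rpow hp0]
        positivity
      · have hj' : (0 : ℝ) < j := by exact_mod_cast hj
        have hs := Real.sqrt_pos.mpr hj'
        have hle : √(j : ℝ) ≤ √((j + 1 : ℤ) : ℝ) := Real.sqrt_le_sqrt (by push_cast; linarith)
        have hdiff : √((j + 1 : ℤ) : ℝ) - √(j : ℝ) ≤ (√(j : ℝ))⁻¹ := by
          rw [← one_div, le_div_iff₀ hs]
          have h₁ := Real.mul_self_sqrt hj'.le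
          have h₂ := Real.mul_self_sqrt (show (0 : ℝ) ≤ (j + 1 : ℤ) by push_cast; linarith)
          push_cast at *
          nlinarith
        calc |√((j + 1 : ℤ) : ℝ) - √(j : ℝ)| ^ p ≤ ((√(j : ℝ))⁻¹) ^ p := by
              rw [abs_of_nonneg (sub_nonneg.mpr hle)]
              exact Real.rpow_le_rpow (sub_nonneg.mpr hle) hdiff (by linarith)
          _ = |(j : ℝ)| ^ (-(p / 2)) := by
              rw [abs_of_pos hj', Real.inv_rpow hs.le, Real.sqrt_eq_rpow, ← Real.rpow_mul hj'.le,
                Real.rpow_neg hj'.le]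
              ring_nf
    · rcases M with _ | M
      · rw [Nat.cast_zero, Real.zero_rpow (by positivity)]; simp
      · refine le_trans (le_of_eq ?_) (Finset.single_le_sum
          (f := fun j : ℕ => |√(((j : ℤ) + 1 : ℤ) : ℝ)| ^ p) (fun _ _ => by positivity)
          (Finset.self_mem_range_succ M))
        rw [abs_of_nonneg (Real.sqrt_nonneg _), Real.sqrt_eq_rpow,
          ← Real.rpow_mul (by positivity)]
        push_cast
        ring_nf

section Lp

variable {p : ℝ≥0∞} [Fact (1 ≤ p)]

theorem toReal_pos_of_one_le (hp : p ≠ ∞) : 0 < p.toReal :=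
  ENNReal.toReal_pos (zero_lt_one.trans_le Fact.out).ne' hp

/-- Extension by zero along an injection: the resulting vector of `ℓ^p`. -/
theorem exists_lp_extend (hp : p ≠ ∞) {ι κ : Type*} {e : κ → ι} (he : Function.Injective e)
    {c : κ → ℝ} (hc : Summable fun i => |c i| ^ p.toReal) :
    ∃ v : lp (fun _ : ι => ℝ) p, ⇑v = Function.extend e c 0 ∧
      ‖v‖ = (∑' i, |c i| ^ p.toReal) ^ (1 / p.toReal) := by
  have hp0 := toReal_pos_of_one_le hp
  have h : (fun i => ‖Function.extend e c 0 i‖ ^ p.toReal) =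
      Function.extend e (fun i => |c i| ^ p.toReal) 0 := by
    funext i
    by_cases hi : ∃ k, e k = i
    · obtain ⟨k, rfl⟩ := hi
      rw [he.extend_apply, he.extend_apply, Real.norm_eq_abs]
    · rw [Function.extend_apply' _ _ _ hi, Function.extend_apply' _ _ _ hi]
      simp [hp0.ne']
  have hs := (hasSum_extend_zero he).mpr hc.hasSum
  rw [← h] at hs
  refine ⟨⟨Function.extend e c 0, memℓp_gen hs.summable⟩, rfl, ?_⟩
  rw [lp.norm_eq_tsum_rpow hp0]
  exact congrArg (· ^ (1 / p.toReal)) hs.tsum_eq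

/-- The reindexing of a vector of `ℓ^p`. -/
def lpReindex (hp : p ≠ ∞) {ι κ : Type*} (e : ι ≃ κ) (v : lp (fun _ : ι => ℝ) p) :
    lp (fun _ : κ => ℝ) p :=
  ⟨fun k => v (e.symm k), memℓp_gen <|
    (e.symm.summable_iff (f := fun i => ‖v i‖ ^ p.toReal)).mpr
      ((lp.memℓp v).summable (toReal_pos_of_one_le hp))⟩

theorem norm_lpReindex_sub (hp : p ≠ ∞) {ι κ : Type*} (e : ι ≃ κ) (v w : lp (fun _ : ι => ℝ) p) :
    ‖lpReindex hp e v - lpReindex hp e w‖ = ‖v - w‖ := by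
  have hp0 := toReal_pos_of_one_le hp
  rw [lp.norm_eq_tsum_rpow hp0, lp.norm_eq_tsum_rpow hp0, ← e.symm.tsum_eq]
  rfl

end Lp

namespace ZwrZ

/-- The coordinates of the embedding: `(ε, k, w)` stands for the event that the lamps on the
half-line that starts at `k` in the direction `ε` are set to `w`, and `k` for the lamp at `k`. -/
abbrev Coord : Type := (ℤˣ × ℤ × (ℤ →₀ ℤ)) ⊕ ℤ

/-- The restriction of `u` to the half-line that starts at `k` in the direction `ε`. -/
def half (ε : ℤˣ) (k : ℤ) (u : ℤ →₀ ℤ) : ℤ →₀ ℤ := u.filter fun j => 0 ≤ (ε : ℤ) * (j - k)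

/-- The coordinates of `x`. At `(ε, k, w)` it is `φ` of the distance from the cursor ahead to the
half-line, provided that `w` is the configuration of `x` on it. These functions are not in `ℓ^p`,
but their differences are. -/
def coord (φ : ℤ → ℝ) (x : ZwrZ) : Coord → ℝ :=
  Sum.elim (fun i => if i.2.2 = half i.1 i.2.1 (lamp x) then φ (i.1 * (i.2.1 - pos x)) else 0)
    fun k => lamp x k

theorem half_add_single {ε : ℤˣ} {k m : ℤ} (h : 0 < (ε : ℤ) * (k - m)) (u : ℤ →₀ ℤ) (c : ℤ) :
    half ε k (u + Finsupp.single m c) = half ε k u := by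
  rw [half, Finsupp.filter_add, Finsupp.filter_single_of_neg, add_zero]; · rfl
  rw [not_le, ← neg_sub, mul_neg]; omega

theorem half_ne {ε : ℤˣ} {k j : ℤ} {u v : ℤ →₀ ℤ} (huv : u j ≠ v j) (h : 0 ≤ (ε : ℤ) * (j - k)) :
    half ε k u ≠ half ε k v := fun heq => huv <| by
  have := congrArg (fun w : ℤ →₀ ℤ => w j) heq
  simpa only [half, Finsupp.filter_apply_pos (fun j => 0 ≤ (ε : ℤ) * (j - k)) _ h] using this

theorem units_mul_self_mul (ε : ℤˣ) (a : ℤ) : (ε : ℤ) * (ε * a) = a := by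
  rw [← mul_assoc, ← Units.val_mul, Int.units_mul_self, Units.val_one, one_mul]

section Embedding

variable {p : ℝ≥0∞} [Fact (1 ≤ p)] {φ : ℤ → ℝ}

variable (p φ) in
/-- The elements by which right multiplication moves the coordinates a bounded `ℓ^p` distance. -/
def boundedSubgroup : Subgroup ZwrZ where
  carrier := {g | ∃ C, ∀ x, ∃ v : lp (fun _ : Coord => ℝ) p,
    ⇑v = coord φ (x * g) - coord φ x ∧ ‖v‖ ≤ C}
  one_mem' := ⟨0, fun x => ⟨0, by simp; rfl, by simp⟩⟩
  mul_mem' := by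
    rintro g h ⟨C, hC⟩ ⟨D, hD⟩
    refine ⟨C + D, fun x => ?_⟩
    obtain ⟨v, hv, hv'⟩ := hC x
    obtain ⟨w, hw, hw'⟩ := hD (x * g)
    refine ⟨v + w, ?_, (norm_add_le _ _).trans (add_le_add hv' hw')⟩
    rw [lp.coeFn_add, hv, hw, mul_assoc, sub_add_sub_cancel']
  inv_mem' := by
    rintro g ⟨C, hC⟩
    refine ⟨C, fun x => ?_⟩
    obtain ⟨v, hv, hv'⟩ := hC (x * g⁻¹)
    exact ⟨-v, by rw [lp.coeFn_neg, hv, inv_mul_cancel_right, neg_sub], by rwa [norm_neg]⟩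

theorem toggle_mem_boundedSubgroup (hφ : ∀ j ≤ 0, φ j = 0) : toggle ∈ boundedSubgroup p φ := by
  have hp0 : 0 < p := zero_lt_one.trans_le Fact.out
  refine ⟨1, fun x => ⟨lp.single p (Sum.inr (pos x)) 1, ?_, by rw [lp.norm_single hp0]; simp⟩⟩
  have hlamp : lamp (x * toggle) = lamp x + Finsupp.single (pos x) 1 := by
    ext j
    simp only [lamp_mul_apply, toggle, lamp_mk, Finsupp.add_apply, Finsupp.single_apply]
    congr 2
    exact propext ⟨fun h => by omega, fun h => by omega⟩
  have hpos : pos (x * toggle) = pos x := by simp [toggle]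
  funext i
  rcases i with ⟨ε, k, w⟩ | k
  · rw [lp.single_apply_ne _ _ _ (by simp)]
    simp only [coord, Pi.sub_apply, Sum.elim_inl, hlamp, hpos]
    rcases le_or_gt ((ε : ℤ) * (k - pos x)) 0 with h | h
    · simp [hφ _ h]
    · rw [half_add_single h, sub_self]
  · simp only [coord, Pi.sub_apply, Sum.elim_inr, hlamp]
    by_cases hk : k = pos x
    · subst hk
      simp
    · rw [lp.single_apply_ne _ _ _ (by simpa using hk)]
      simp [Ne.symm hk]

theorem move_mem_boundedSubgroup (hp : p ≠ ∞)
    (hsum : Summable fun j => |φ (j + 1) - φ j| ^ p.toReal) : move ∈ boundedSubgroup p φ := by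
  set c : ℤˣ → ℤ → ℝ := fun ε i => φ (i - ε) - φ i with hc
  have hcs (ε : ℤˣ) : Summable fun i => |c ε i| ^ p.toReal := by
    rcases Int.units_eq_one_or ε with rfl | rfl
    · refine ((Equiv.subRight (1 : ℤ)).summable_iff.mpr hsum).congr fun i => ?_
      simp [hc, abs_sub_comm]
    · simpa [hc] using hsum
  refine ⟨(∑' i, |c 1 i| ^ p.toReal) ^ (1 / p.toReal) +
    (∑' i, |c (-1) i| ^ p.toReal) ^ (1 / p.toReal), fun x => ?_⟩
  set e : ℤˣ → ℤ → Coord := fun ε i =>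
    Sum.inl (ε, pos x + ε * i, half ε (pos x + ε * i) (lamp x)) with he
  have hinj (ε : ℤˣ) : Function.Injective (e ε) := fun i j hij => by
    simp only [he, Sum.inl.injEq, Prod.mk.injEq, add_right_inj] at hij
    exact mul_left_cancel₀ ε.ne_zero hij.2.1
  obtain ⟨v, hv, hv'⟩ := exists_lp_extend hp (hinj 1) (hcs 1)
  obtain ⟨w, hw, hw'⟩ := exists_lp_extend hp (hinj (-1)) (hcs (-1))
  refine ⟨v + w, ?_, (norm_add_le _ _).trans (by rw [hv', hw'])⟩
  have hlamp : lamp (x * move) = lamp x := by ext j; simp [lamp_mul_apply, move]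
  have hpos : pos (x * move) = pos x + 1 := rfl
  rw [lp.coeFn_add, hv, hw]
  funext i
  rw [Pi.add_apply, Pi.sub_apply]
  have hne (ε ε' : ℤˣ) (hε : ε ≠ ε') (k : ℤ) (w : ℤ →₀ ℤ) :
      Function.extend (e ε) (c ε) 0 (Sum.inl (ε', k, w)) = 0 := by
    refine Function.extend_apply' _ _ _ ?_
    rintro ⟨j, hj⟩
    simp only [he, Sum.inl.injEq, Prod.mk.injEq] at hj
    exact hε hj.1
  have heq (ε : ℤˣ) (k : ℤ) (w : ℤ →₀ ℤ) :
      Function.extend (e ε) (c ε) 0 (Sum.inl (ε, k, w)) =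
        coord φ (x * move) (Sum.inl (ε, k, w)) - coord φ x (Sum.inl (ε, k, w)) := by
    simp only [coord, Sum.elim_inl, hlamp, hpos]
    have hk : pos x + ε * (ε * (k - pos x)) = k := by rw [units_mul_self_mul]; ring
    by_cases h : w = half ε k (lamp x)
    · have hi : Sum.inl (ε, k, w) = e ε (ε * (k - pos x)) := by simp only [he, hk, h]
      rw [hi, (hinj ε).extend_apply, if_pos h, if_pos h]
      simp only [hc]
      ring_nf
    · rw [if_neg h, if_neg h, sub_zero]
      refine Function.extend_apply' _ _ _ ?_
      rintro ⟨j, hj⟩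
      simp only [he, Sum.inl.injEq, Prod.mk.injEq, true_and] at hj
      exact h (by rw [← hj.2, hj.1])
  rcases i with ⟨ε, k, u⟩ | k
  · rcases Int.units_eq_one_or ε with rfl | rfl
    · rw [hne (-1) 1 (by decide), heq, add_zero]
    · rw [hne 1 (-1) (by decide), heq, zero_add]
  · rw [Function.extend_apply' _ _ _ (by rintro ⟨j, hj⟩; simp [he] at hj),
      Function.extend_apply' _ _ _ (by rintro ⟨j, hj⟩; simp [he] at hj)]
    simp [coord, hlamp]

/-- If every half-line that starts within `[1, M]` of the cursor of `x` in the direction `ε` sees a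
difference between `x` and `y`, or does not lie ahead of the cursor of `y`, then the coordinates of
`x` and `y` are at distance at least `√M`. -/
theorem sqrt_le_norm_of_half (hp : p ≠ ∞) (hφ : ∀ j ≤ 0, φ j = 0)
    (hgrow : ∀ M : ℕ, (M : ℝ) ^ (p.toReal / 2) ≤
      ∑ j ∈ Finset.range M, |φ (j + 1)| ^ p.toReal)
    {x y : ZwrZ} {v : lp (fun _ : Coord => ℝ) p} (hv : ⇑v = coord φ y - coord φ x)
    (ε : ℤˣ) (M : ℕ)
    (h : ∀ j : ℕ, j < M →
      half ε (pos x + ε * (j + 1)) (lamp x) ≠ half ε (pos x + ε * (j + 1)) (lamp y) ∨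
        (ε : ℤ) * (pos x + ε * (j + 1) - pos y) ≤ 0) :
    √M ≤ ‖v‖ := by
  have hp0 := toReal_pos_of_one_le hp
  set e : ℕ → Coord := fun j =>
    Sum.inl (ε, pos x + ε * (j + 1), half ε (pos x + ε * (j + 1)) (lamp x)) with he
  have hinj : Function.Injective e := fun i j hij => by
    simp only [he, Sum.inl.injEq, Prod.mk.injEq, add_right_inj] at hij
    simpa using mul_left_cancel₀ ε.ne_zero hij.2.1
  have hval (j : ℕ) (hj : j < M) : v (e j) = -φ (j + 1) := by
    rw [hv, Pi.sub_apply]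
    simp only [coord, he, Sum.elim_inl, if_true, add_sub_cancel_left, units_mul_self_mul]
    rcases h j hj with h | h
    · rw [if_neg h, zero_sub]
    · rw [hφ _ h, ite_self, zero_sub]
  rw [← Real.rpow_le_rpow_iff (Real.sqrt_nonneg _) (norm_nonneg v) hp0]
  calc √M ^ p.toReal = (M : ℝ) ^ (p.toReal / 2) := by
        rw [Real.sqrt_eq_rpow, ← Real.rpow_mul (Nat.cast_nonneg M)]; ring_nf
    _ ≤ ∑ j ∈ Finset.range M, |φ (j + 1)| ^ p.toReal := hgrow M
    _ = ∑ i ∈ (Finset.range M).map ⟨e, hinj⟩, ‖v i‖ ^ p.toReal := by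
        rw [Finset.sum_map]
        refine Finset.sum_congr rfl fun j hj => ?_
        rw [Function.Embedding.coeFn_mk, hval j (Finset.mem_range.mp hj), norm_neg,
          Real.norm_eq_abs]
    _ ≤ ‖v‖ ^ p.toReal := lp.sum_rpow_le_norm_rpow hp0 v _

theorem exists_unit_mul_natAbs (d : ℤ) : ∃ ε : ℤˣ, d = ε * d.natAbs := by
  rcases le_total 0 d with h | h
  · exact ⟨1, by simp [abs_of_nonneg h]⟩
  · exact ⟨-1, by simp [abs_of_nonpos h]⟩

theorem sqrt_le_norm (hp : p ≠ ∞) (hφ : ∀ j ≤ 0, φ j = 0)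
    (hgrow : ∀ M : ℕ, (M : ℝ) ^ (p.toReal / 2) ≤
      ∑ j ∈ Finset.range M, |φ (j + 1)| ^ p.toReal)
    {x y : ZwrZ} {v : lp (fun _ : Coord => ℝ) p} (hv : ⇑v = coord φ y - coord φ x)
    (k : ℤ) (hk : k = pos y ∨ lamp x k ≠ lamp y k) : √((k - pos x).natAbs : ℝ) ≤ ‖v‖ := by
  obtain ⟨ε, hε⟩ := exists_unit_mul_natAbs (k - pos x)
  generalize (k - pos x).natAbs = M at hε ⊢
  obtain rfl : k = pos x + ε * M := by omega
  refine sqrt_le_norm_of_half hp hφ hgrow hv ε M fun j hj => ?_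
  rcases hk with hk | hk
  · refine Or.inr ?_
    rw [← hk, add_sub_add_left_eq_sub, ← mul_sub, units_mul_self_mul]
    omega
  · refine Or.inl (half_ne hk ?_)
    rw [add_sub_add_left_eq_sub, ← mul_sub, units_mul_self_mul]
    omega

variable (p) in
/-- A map to `ℓ^p` that is bounded under right multiplication by each element, and from whose
distances the cursor and the lamps can be estimated. -/
theorem exists_embedding (hp : p ≠ ∞) : ∃ f : ZwrZ → lp (fun _ : ℕ => ℝ) p,
    (∀ g, ∃ C, ∀ x, ‖f (x * g) - f x‖ ≤ C) ∧
    (∀ x y k, k = pos y ∨ lamp x k ≠ lamp y k → √((k - pos x).natAbs : ℝ) ≤ ‖f y - f x‖) ∧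
    ∀ x y k, ((lamp y k - lamp x k).natAbs : ℝ) ≤ ‖f y - f x‖ := by
  obtain ⟨φ, hφ, hsum, hgrow⟩ := exists_profile (p := p.toReal)
    (by simpa using ENNReal.toReal_mono hp (Fact.out : 1 ≤ p))
  have hmem := mem_of_generators (boundedSubgroup p φ) (move_mem_boundedSubgroup hp hsum)
    (toggle_mem_boundedSubgroup hφ)
  have hex (x : ZwrZ) : ∃ v : lp (fun _ : Coord => ℝ) p, ⇑v = coord φ x - coord φ 1 := by
    obtain ⟨C, hC⟩ := hmem x
    obtain ⟨v, hv, -⟩ := hC 1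
    exact ⟨v, by rw [hv, one_mul]⟩
  choose f hf using hex
  have hdiff (x y : ZwrZ) : ⇑(f y - f x) = coord φ y - coord φ x := by
    rw [lp.coeFn_sub, hf, hf, sub_sub_sub_cancel_right]
  obtain ⟨_⟩ := nonempty_denumerable Coord
  refine ⟨fun x => lpReindex hp (Denumerable.eqv Coord) (f x), fun g => ?_, fun x y k hk => ?_,
    fun x y k => ?_⟩
  · obtain ⟨C, hC⟩ := hmem g
    refine ⟨C, fun x => ?_⟩
    obtain ⟨v, hv, hvC⟩ := hC x
    rw [norm_lpReindex_sub, lp.ext ((hdiff x (x * g)).trans hv.symm)]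
    exact hvC
  · rw [norm_lpReindex_sub]
    exact sqrt_le_norm hp hφ hgrow (hdiff x y) k hk
  · rw [norm_lpReindex_sub]
    have h := lp.norm_apply_le_norm (zero_lt_one.trans_le (Fact.out : 1 ≤ p)).ne' (f y - f x)
      (Sum.inr k)
    rw [hdiff] at h
    simpa [coord] using h

end Embedding

end ZwrZ

/-! ### The compression rate -/

section WordMetric

variable {S : Set ZwrZ}

theorem coe_nndist_wordMetricSpace (hS : Subgroup.closure S = ⊤) (x y : WordMetricSpace S hS) :
    (nndist x y : ℝ) =
      wordLength S ((show ZwrZ from x)⁻¹ * (show ZwrZ from y)) := rfl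

open ZwrZ in
/-- The word length of `x⁻¹ y` is at most cubic in the distance of the images: if that distance is
`N`, then `x` and `y` differ only within `N²` of the cursor, by at most `N` at each place. -/
theorem exists_wordLength_le_cube (hS : Subgroup.closure S = ⊤) {p : ℝ≥0∞} [Fact (1 ≤ p)]
    (f : ZwrZ → lp (fun _ : ℕ => ℝ) p)
    (h₁ : ∀ x y k, k = pos y ∨ lamp x k ≠ lamp y k → √((k - pos x).natAbs : ℝ) ≤ ‖f y - f x‖)
    (h₂ : ∀ x y k, ((lamp y k - lamp x k).natAbs : ℝ) ≤ ‖f y - f x‖) :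
    ∃ C : ℝ≥0, 0 < C ∧ ∀ x y, (wordLength S (x⁻¹ * y) : ℝ) ≤ C * (‖f y - f x‖ + 1) ^ 3 := by
  obtain ⟨C, hC⟩ := exists_wordLength_le hS
  refine ⟨C + 1, by positivity, fun x y => ?_⟩
  set N := ‖f y - f x‖ with hN
  have hN0 : 0 ≤ N := norm_nonneg _
  have hM (k : ℤ) (hk : k = pos y ∨ lamp x k ≠ lamp y k) : (k - pos x).natAbs ≤ ⌊N ^ 2⌋₊ :=
    Nat.le_floor ((Real.sqrt_le_left hN0).mp (h₁ x y k hk))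
  have h := hC (x⁻¹ * y) ⌊N ^ 2⌋₊ ⌊N⌋₊ (fun j hj => ?_) (fun j => ?_) ?_
  · have hM' := Nat.floor_le (sq_nonneg N)
    have hB' := Nat.floor_le hN0
    calc (wordLength S (x⁻¹ * y) : ℝ) ≤ C * ((⌊N ^ 2⌋₊ + 1) * (⌊N⌋₊ + 1)) := by exact_mod_cast h
      _ ≤ C * ((N ^ 2 + 1) * (N + 1)) := by gcongr
      _ ≤ (C + 1) * (N + 1) ^ 3 := by
          gcongr
          · linarith
          · nlinarith [mul_nonneg hN0 hN0, mul_nonneg hN0 (mul_nonneg hN0 hN0)]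
      _ = ((C + 1 : ℝ≥0) : ℝ) * (N + 1) ^ 3 := by push_cast; rfl
  · rw [lamp_inv_mul_apply, sub_ne_zero] at hj
    simpa using hM (pos x + j) (Or.inr hj.symm)
  · rw [lamp_inv_mul_apply]
    exact Nat.le_floor (h₂ x y _)
  · rw [pos_mul, pos_inv, neg_add_eq_sub]
    exact hM (pos y) (Or.inl rfl)

/-- The lower control function `(t / C)^(1/3) - 1` dominates half of `(t / C)^(1/3)`. -/
theorem eventually_half_rpow_le {C : ℝ≥0} (hC : 0 < C) :
    ∀ᶠ t : ℝ≥0 in atTop, 1 / 2 * (C⁻¹ * t) ^ (((1 / 3 : ℝ≥0) : ℝ)) ≤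
      (C⁻¹ * t) ^ (((1 / 3 : ℝ≥0) : ℝ)) - 1 := by
  filter_upwards [eventually_ge_atTop (8 * C)] with t ht
  have h : 2 ≤ (C⁻¹ * t) ^ (((1 / 3 : ℝ≥0) : ℝ)) := by
    have h8 : (2 : ℝ≥0) ^ (3 : ℝ) ≤ C⁻¹ * t := by
      rw [show (2 : ℝ≥0) ^ (3 : ℝ) = 8 by norm_num, ← div_eq_inv_mul, le_div_iff₀ hC]
      exact ht
    calc (2 : ℝ≥0) = ((2 : ℝ≥0) ^ (3 : ℝ)) ^ (((1 / 3 : ℝ≥0) : ℝ)) := by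
          rw [← NNReal.rpow_mul]; norm_num
      _ ≤ _ := NNReal.rpow_le_rpow h8 (NNReal.coe_nonneg _)
  refine le_tsub_of_add_le_right ?_
  rw [← NNReal.coe_le_coe] at h ⊢
  push_cast at *
  linarith

theorem tendsto_mul_rpow_atTop {C : ℝ≥0} (hC : 0 < C) {a : ℝ} (ha : 0 < a) :
    Tendsto (fun t : ℝ≥0 => 1 / 2 * (C⁻¹ * t) ^ a) atTop atTop := by
  have h : Tendsto (fun t : ℝ => 1 / 2 * ((C : ℝ)⁻¹ * t) ^ a) atTop atTop :=
    Tendsto.const_mul_atTop (by norm_num) <| (tendsto_rpow_atTop ha).comp <|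
      Tendsto.const_mul_atTop (by positivity) tendsto_id
  rw [← NNReal.tendsto_coe_atTop]
  refine (h.comp (NNReal.tendsto_coe_atTop.mpr tendsto_id)).congr fun t => ?_
  simp

theorem one_third_le_lpCompressionRate (hfin : S.Finite) (hS : Subgroup.closure S = ⊤)
    (p : ℝ≥0∞) [Fact (1 ≤ p)] (hp : p ≠ ∞) :
    1 / 3 ≤ lpCompressionRate p (WordMetricSpace S hS) := by
  obtain ⟨f, hf, h₁, h₂⟩ := ZwrZ.exists_embedding p hp
  obtain ⟨K, hK⟩ := exists_norm_sub_le_mul_wordLength hfin hS f hf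
  obtain ⟨C, hC, hCle⟩ := exists_wordLength_le_cube hS f h₁ h₂
  refine le_sSup ⟨1 / 3, by norm_num, f, fun t => (C⁻¹ * t) ^ (((1 / 3 : ℝ≥0) : ℝ)) - 1,
    fun t => K * t, ⟨fun s t hst => ?_, fun s t hst => mul_le_mul_right hst K, fun x y => ?_,
    fun x y => ?_, ?_⟩, 1 / 2, by positivity, C⁻¹, by positivity, eventually_half_rpow_le hC⟩
  · exact tsub_le_tsub_right (NNReal.rpow_le_rpow (by gcongr) (NNReal.coe_nonneg _)) 1
  · rw [tsub_le_iff_right]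
    have h : C⁻¹ * nndist x y ≤ (nndist (f x) (f y) + 1) ^ (3 : ℝ) := by
      rw [inv_mul_le_iff₀ hC, ← NNReal.coe_le_coe, coe_nndist_wordMetricSpace]
      have := hCle x y
      rw [← dist_eq_norm, dist_comm] at this
      push_cast
      exact_mod_cast this
    calc (C⁻¹ * nndist x y) ^ (((1 / 3 : ℝ≥0) : ℝ))
        ≤ ((nndist (f x) (f y) + 1) ^ (3 : ℝ)) ^ (((1 / 3 : ℝ≥0) : ℝ)) :=
          NNReal.rpow_le_rpow h (NNReal.coe_nonneg _)
      _ = nndist (f x) (f y) + 1 := by rw [← NNReal.rpow_mul]; norm_num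
  · rw [← NNReal.coe_le_coe, NNReal.coe_mul, coe_nndist_wordMetricSpace]
    have := hK x y
    rw [← dist_eq_norm, dist_comm] at this
    exact this
  · exact tendsto_atTop_mono' _ (eventually_half_rpow_le hC)
      (tendsto_mul_rpow_atTop hC (by norm_num))

/-! ### The asymptotic dimension -/

/-- The embedding of `ℤⁿ` by lamp configurations supported on `{0, …, n - 1}`. -/
def latticePoint {n : ℕ} (x : Fin n → ℤ) : ZwrZ :=
  ZwrZ.mk ((Finsupp.equivFunOnFinite.symm x).embDomain (Fin.valEmbedding.trans Nat.castEmbedding)) 0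

theorem lamp_latticePoint {n : ℕ} (x : Fin n → ℤ) (j : Fin n) :
    ZwrZ.lamp (latticePoint x) (j : ℕ) = x j := by
  rw [latticePoint, ZwrZ.lamp_mk]
  exact Finsupp.embDomain_apply_self (Fin.valEmbedding.trans Nat.castEmbedding) _ j

theorem inv_mul_latticePoint {n : ℕ} (x y : Fin n → ℤ) :
    (latticePoint x)⁻¹ * latticePoint y = latticePoint (y - x) := by
  rw [inv_mul_eq_iff_eq_mul]
  refine ZwrZ.ext ?_ rfl
  ext j
  rw [ZwrZ.lamp_mul_apply]
  simp only [latticePoint, ZwrZ.lamp_mk, ZwrZ.pos_mk, sub_zero, ← Finsupp.add_apply,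
    ← Finsupp.embDomain_add]
  congr 2
  ext i
  simp

theorem exists_wordLength_latticePoint_le (S : Set ZwrZ) (n : ℕ) (R : ℤ) :
    ∃ C : ℕ, ∀ x y : Fin n → ℤ, (∀ j, |x j - y j| ≤ R) →
      wordLength S ((latticePoint x)⁻¹ * latticePoint y) ≤ C := by
  obtain ⟨C, hC⟩ := ((Set.finite_Icc (fun _ : Fin n => -R) (fun _ => R)).image
    fun z => wordLength S (latticePoint z)).bddAbove
  refine ⟨C, fun x y h => ?_⟩
  rw [inv_mul_latticePoint]
  refine hC ⟨y - x, ⟨fun j => ?_, fun j => ?_⟩, rfl⟩ <;>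
  · have := abs_le.mp (h j)
    simp only [Pi.sub_apply]
    omega

theorem exists_abs_lamp_sub_le (hfin : S.Finite) (hS : Subgroup.closure S = ⊤) :
    ∃ C : ℝ≥0, ∀ (x y : ZwrZ) (k : ℤ),
      (|ZwrZ.lamp y k - ZwrZ.lamp x k| : ℤ) ≤ (C : ℝ) * wordLength S (x⁻¹ * y) := by
  obtain ⟨f, hf, -, h₂⟩ := ZwrZ.exists_embedding 1 ENNReal.one_ne_top
  obtain ⟨K, hK⟩ := exists_norm_sub_le_mul_wordLength hfin hS f hf
  refine ⟨K, fun x y k => ?_⟩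
  refine le_trans (le_of_eq ?_) ((h₂ x y k).trans (hK x y))
  rw [Nat.cast_natAbs]

/-- A cover with mesh `s`, multiplicity `m` and large Lebesgue number restricts to the embedded
lattice `ℤᵐ`; sending each point to a chosen point of a member of the cover that contains a large
ball around it is a map at bounded distance from the identity. Its `m + 1` distinct values at
neighbouring points come from `m + 1` members of the cover with a common point. -/
theorem not_asdimLT (hfin : S.Finite) (hS : Subgroup.closure S = ⊤) (m : ℕ) :
    ¬ AsdimLT (WordMetricSpace S hS) m := by
  intro hdim
  let ψ : (Fin m → ℤ) → WordMetricSpace S hS := fun x => latticePoint x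
  obtain ⟨C, hC⟩ := exists_wordLength_latticePoint_le S m (2 * (m + 1))
  obtain ⟨K, hK⟩ := exists_abs_lamp_sub_le hfin hS
  obtain ⟨s, U, -, hmesh, hmult, hleb⟩ := hdim (C + 1)
  have hball (x : Fin m → ℤ) : ∃ u ∈ U, ∀ y, dist y (ψ x) ≤ C → y ∈ u := by
    have h : (C : ℝ≥0∞) < lebesgueNumberAt U (ψ x) :=
      lt_of_lt_of_le (by exact_mod_cast Nat.lt_succ_self C)
        (hleb.trans (iInf_le _ (ψ x)))
    obtain ⟨_, ⟨r, rfl, u, hu, hru⟩, hCr⟩ := lt_sSup_iff.mp h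
    refine ⟨u, hu, fun y hy => hru (lt_of_le_of_lt hy ?_)⟩
    exact_mod_cast hCr
  choose V hVU hV using hball
  have hmem (x : Fin m → ℤ) : ψ x ∈ V x := hV x _ (by simp)
  have hpick (u : Set (WordMetricSpace S hS)) : ∃ z, (∃ x, ψ x ∈ u) → ψ z ∈ u := by
    by_cases h : ∃ x, ψ x ∈ u
    · exact h.imp fun _ hz _ => hz
    · exact ⟨0, fun h' => absurd h' h⟩
  choose z hz using hpick
  have hr (x : Fin m → ℤ) (j : Fin m) : |z (V x) j - x j| ≤ ⌈K * s⌉₊ := by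
    have h₁ : edist (ψ x) (ψ (z (V x))) ≤ s :=
      (Metric.edist_le_ediam_of_mem (hmem x) (hz _ ⟨x, hmem x⟩)).trans
        ((le_iSup₂ (f := fun u (_ : u ∈ U) => Metric.ediam u) (V x) (hVU x)).trans hmesh)
    rw [edist_nndist, ENNReal.coe_le_coe, ← NNReal.coe_le_coe, coe_nndist_wordMetricSpace] at h₁
    have h₂ := hK (latticePoint x) (latticePoint (z (V x))) (j : ℕ)
    rw [lamp_latticePoint, lamp_latticePoint] at h₂
    have h₃ : (|z (V x) j - x j| : ℤ) ≤ ((K * s : ℝ≥0) : ℝ) := by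
      rw [NNReal.coe_mul]
      exact h₂.trans (mul_le_mul_of_nonneg_left h₁ K.2)
    have h₄ : ((K * s : ℝ≥0) : ℝ) ≤ (⌈K * s⌉₊ : ℝ) := by exact_mod_cast Nat.le_ceil (K * s)
    exact_mod_cast h₃.trans h₄
  obtain ⟨w, hw, hclose⟩ := Kuhn.exists_rainbow (fun x => z (V x)) _ hr
  have hVinj : Function.Injective fun i => V (w i) := fun i k hik => hw (congrArg z hik)
  have hsub : Set.range (fun i => V (w i)) ⊆ {u ∈ U | ψ (w 0) ∈ u} := by
    rintro _ ⟨i, rfl⟩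
    refine ⟨hVU _, hV _ _ ?_⟩
    exact Nat.cast_le.mpr <| hC (w 0) (w i) fun j => hclose 0 i j
  have hcard : ((m + 1 : ℕ) : ℕ∞) ≤ m := by
    calc ((m + 1 : ℕ) : ℕ∞) = (Set.range fun i => V (w i)).encard := by
          rw [← Set.image_univ, hVinj.encard_image]; simp
      _ ≤ {u ∈ U | ψ (w 0) ∈ u}.encard := Set.encard_le_encard hsub
      _ ≤ coverMultiplicity U := le_iSup (fun x => {u ∈ U | x ∈ u}.encard) (ψ (w 0))
      _ ≤ m := hmult
  exact absurd (Nat.cast_le.mp hcard) (by omega)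

end WordMetric

end

theorem corollary4p2p8 (S : Set ZwrZ) (hfin : S.Finite) (hS : Subgroup.closure S = ⊤) :
    (∀ (p : ℝ≥0∞) [Fact (1 ≤ p)], p ≠ ∞ →
      1 / 3 ≤ lpCompressionRate p (WordMetricSpace S hS)) ∧
    asymptoticDimension (WordMetricSpace S hS) = ⊤ := by
  refine ⟨fun p _ hp => one_third_le_lpCompressionRate hfin hS p hp, sInf_eq_top.mpr ?_⟩
  rintro _ ⟨k, -, hk⟩
  exact absurd hk (not_asdimLT hfin hS (k + 1))
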